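/- \textbf{Setting.} Let $x_1,x_2:\mathbb{R}\dashrightarrow\mathbb{R}^3$ be triples of real rational functions of one parameter, and let $\mathcal{C}_1,\mathcal{C}_2\subset\mathbb{R}^3$ be the algebraic curves they parametrize (the Zariski closures in $\mathbb{R}^3$ of the sets of points $x_1(t)$, resp. $x_2(t)$). Assume that $x_1,x_2$ are proper, i.e. birational onto their curves. Write \[ \kappa_{x}=\frac{\|x'\times x''\|}{\|x'\|^3},\qquad \tau_{x}=\frac{\langle x'\times x'',x'''\rangle}{\|x'\times x''\|^2} \] for curvature and torsion, and assume that both curves are helical: they are nonplanar and each ratio $\kappa_{x_i}/\tau_{x_i}$ is constant. Write the rational functions $\kappa_{x_i}^2=A_i/B_i$ and $\tau_{x_i}=C_i/D_i$ with coprime pairs $(A_i,B_i)$ and $(C_i,D_i)$ of real polynomials, and, with $\lambda$ a variable, put \[ K_\lambda(t,s)=A_1(t)B_2(s)-\lambda^2A_2(s)B_1(t),\qquad T_\lambda(t,s)=C_1(t)D_2(s)-\lambda\,C_2(s)D_1(t). \] Let $G=G_\lambda(t,s)$ be a greatest common divisor of $K_\lambda$ and $T_\lambda$ in $\mathbb{R}[\lambda,t,s]$.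 Let $t_0\in\mathbb{R}$ be such that the leading coefficient $\mathrm{lc}_s(G)\in\mathbb{R}[\lambda,t]$ of $G$ with respect to $s$, evaluated at $t=t_0$, is not the zero polynomial in $\lambda$; call this evaluation $L(\lambda)$. Define \[ \mathcal{S}_1=\{0\ne\lambda\in\mathbb{R}: L(\lambda)=0\}, \] \[ \mathcal{S}_2=\Big\{0\ne\lambda\in\mathbb{R}: G_\lambda(t_0,s)=\frac{\partial G_\lambda}{\partial s}(t_0,s)=0\text{ for some }s\in\mathbb{C}\Big\}. \] Let $s_0$ be a further variable. With subscripts denoting partial derivatives of $G$, all evaluated at $(t_0,s_0)$, let $M=G_s^2G_{tt}-2G_tG_sG_{ts}+G_t^2G_{ss}$ and let $a,b,c,d\in\mathbb{R}[s_0,\lambda]$ be \[ a=-Ms_0-2G_t^2G_s,\quad b=Mt_0s_0+2s_0G_tG_s^2+2t_0G_t^2G_s,\quad c=-M,\quad d=Mt_0+2G_tG_s^2. \] Let $n=\deg_sG$, and let \[ P(t)=(ct+d)^n\,G_\lambda\Big(t,\frac{at+b}{ct+d}\Big)=\sum_i P_i(s_0,\lambda)\,t^i \] be the polynomial obtained by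 clearing denominators. Let $\Lambda\in\mathbb{R}[\lambda]$ be a generator of the elimination ideal $\langle P_i\rangle_i\cap\mathbb{R}[\lambda]$, and put $\mathcal{S}_0=\{0\ne\lambda\in\mathbb{R}:\Lambda(\lambda)=0\}$. \textbf{Theorem.} Suppose $f(\mathcal{C}_1)=\mathcal{C}_2$ for a similarity $f$ with signed ratio $\lambda$, that is, $f(v)=\lambda Qv+b$ with $0\neq\lambda\in\mathbb{R}$, $b\in\mathbb{R}^3$, $Q^{T}Q=I$ and $\det Q=1$. Then $\lambda\in\mathcal{S}_0\cup\mathcal{S}_1\cup\mathcal{S}_2$. -/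

import Mathlib

open scoped Polynomial Matrix

noncomputable section

namespace SimilarCurves

/-! ### Rational space curves

A rational parametrization `ℝ ⇢ ℝ³` is a triple of real rational functions. -/

/-- A rational parametrization `t ↦ (x(t), y(t), z(t))`. -/
abbrev Param := Fin 3 → RatFunc ℝ

/-- `x` is defined at `t`: no component has a pole there. -/
def Param.DefinedAt (x : Param) (t : ℝ) : Prop := ∀ i, (x i).denom.eval t ≠ 0

/-- The point `x(t) ∈ ℝ³` (meaningful where `x` is defined). -/
def Param.point (x : Param) (t : ℝ) : Fin 3 → ℝ := fun i => (x i).eval (RingHom.id ℝ) t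

/-- The algebraic space curve parametrized by `x`: the Zariski closure in `ℝ³` of the
set of the points `x(t)`. -/
def Param.curve (x : Param) : Set (Fin 3 → ℝ) :=
  {p | ∀ q : MvPolynomial (Fin 3) ℝ,
    (∀ t, x.DefinedAt t → MvPolynomial.eval (x.point t) q = 0) → MvPolynomial.eval p q = 0}

/-- `x` is proper, i.e. birational onto its curve: the components of `x` generate the field
of rational functions in the parameter. -/
def Param.IsProper (x : Param) : Prop := IntermediateField.adjoin ℝ (Set.range x) = ⊤

/-- The curve lies in no affine plane `⟨n, p⟩ = d`. -/
def Param.IsNonplanar (x : Param) : Prop :=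
  ¬ ∃ (n : Fin 3 → ℝ) (d : ℝ), n ≠ 0 ∧ ∀ p ∈ x.curve, n ⬝ᵥ p = d

/-- A similarity of `ℝ³` with signed ratio `r`: a map `v ↦ r Q v + b` with `r ≠ 0`
and `Q` a rotation. -/
def IsSimilarity (f : (Fin 3 → ℝ) → (Fin 3 → ℝ)) (r : ℝ) : Prop :=
  r ≠ 0 ∧ ∃ Q ∈ Matrix.specialOrthogonalGroup (Fin 3) ℝ, ∃ b : Fin 3 → ℝ,
    ∀ v, f v = r • (Q *ᵥ v) + b

/-! ### Curvature and torsion -/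

/-- The derivative of a rational function, by the quotient rule. -/
def ratDeriv (r : RatFunc ℝ) : RatFunc ℝ :=
  algebraMap ℝ[X] (RatFunc ℝ)
      (Polynomial.derivative r.num * r.denom - r.num * Polynomial.derivative r.denom) /
    algebraMap ℝ[X] (RatFunc ℝ) (r.denom ^ 2)

/-- The componentwise derivative of a parametrization. -/
def Param.deriv (x : Param) : Param := fun i => ratDeriv (x i)

/-- `κ² = ‖x' × x''‖² / ‖x'‖⁶`, as a rational function. -/
def Param.curvatureSq (x : Param) : RatFunc ℝ :=
  ((x.deriv ⨯₃ x.deriv.deriv) ⬝ᵥ (x.deriv ⨯₃ x.deriv.deriv)) / (x.deriv ⬝ᵥ x.deriv) ^ 3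

/-- `τ = ⟨x' × x'', x'''⟩ / ‖x' × x''‖²`, as a rational function. -/
def Param.torsion (x : Param) : RatFunc ℝ :=
  ((x.deriv ⨯₃ x.deriv.deriv) ⬝ᵥ x.deriv.deriv.deriv) /
    ((x.deriv ⨯₃ x.deriv.deriv) ⬝ᵥ (x.deriv ⨯₃ x.deriv.deriv))

/-- The curvature `κ(t) = ‖x'(t) × x''(t)‖ / ‖x'(t)‖³` (Euclidean norms). -/
def Param.curvature (x : Param) (t : ℝ) : ℝ :=
  √((x.deriv.point t ⨯₃ x.deriv.deriv.point t) ⬝ᵥ (x.deriv.point t ⨯₃ x.deriv.deriv.point t)) /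
    √(x.deriv.point t ⬝ᵥ x.deriv.point t) ^ 3

/-- `x` defines a helical curve: it is nonplanar and `κ / τ` is constant
(wherever it is defined, i.e. up to finitely many parameters). -/
def Param.IsHelical (x : Param) : Prop :=
  x.IsNonplanar ∧ ∃ μ : ℝ, ∀ᶠ t in Filter.cofinite,
    x.curvature t / x.torsion.eval (RingHom.id ℝ) t = μ

/-! ### The polynomials `K` and `T`

Polynomials in `l, t, s` are elements of `ℝ[l][t][s]`: the outermost variable is `s`, the
middle one is `t`, and the innermost one, `l`, stands for the unknown ratio `λ`. -/

/-- `p(t)` as an element of `ℝ[l][t][s]`. -/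
def inT (p : ℝ[X]) : ℝ[X][X][X] := Polynomial.C (p.map Polynomial.C)

/-- `p(s)` as an element of `ℝ[l][t][s]`. -/
def inS (p : ℝ[X]) : ℝ[X][X][X] := p.map (Polynomial.C.comp Polynomial.C)

/-- The variable `l`. -/
def varL : ℝ[X][X][X] := Polynomial.C (Polynomial.C Polynomial.X)

/-- `K = A₁(t) B₂(s) - l² A₂(s) B₁(t)`, where `κᵢ² = Aᵢ / Bᵢ` in lowest terms. -/
def polyK (x₁ x₂ : Param) : ℝ[X][X][X] :=
  inT x₁.curvatureSq.num * inS x₂.curvatureSq.denom -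
    varL ^ 2 * inS x₂.curvatureSq.num * inT x₁.curvatureSq.denom

/-- `T = C₁(t) D₂(s) - l C₂(s) D₁(t)`, where `τᵢ = Cᵢ / Dᵢ` in lowest terms. -/
def polyT (x₁ x₂ : Param) : ℝ[X][X][X] :=
  inT x₁.torsion.num * inS x₂.torsion.denom -
    varL * inS x₂.torsion.num * inT x₁.torsion.denom

/-- `G` is a greatest common divisor of `P` and `Q`. -/
def IsGcd (G P Q : ℝ[X][X][X]) : Prop := ∀ H, H ∣ G ↔ H ∣ P ∧ H ∣ Q

/-! ### The three exceptional sets -/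

/-- `L(l)`: the leading coefficient of `G` with respect to `s`, evaluated at `t = t₀`. -/
def leadCoeffAt (G : ℝ[X][X][X]) (t₀ : ℝ) : ℝ[X] :=
  G.leadingCoeff.eval (Polynomial.C t₀)

/-- `S₁`: the nonzero real roots of `L`. -/
def setS1 (G : ℝ[X][X][X]) (t₀ : ℝ) : Set ℝ :=
  {l | l ≠ 0 ∧ (leadCoeffAt G t₀).eval l = 0}

/-- The partial derivative with respect to `s`. -/
def partialS (G : ℝ[X][X][X]) : ℝ[X][X][X] := Polynomial.derivative G

/-- The partial derivative with respect to `t`. -/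
def partialT (G : ℝ[X][X][X]) : ℝ[X][X][X] :=
  G.sum fun i c => Polynomial.monomial i (Polynomial.derivative c)

/-- `H(t₀, s)`, a polynomial in `ℝ[l][s]`. -/
def atT (H : ℝ[X][X][X]) (t₀ : ℝ) : ℝ[X][X] :=
  H.map (Polynomial.evalRingHom (Polynomial.C t₀))

/-- `S₂`: the nonzero real `l` for which `G_l(t₀, s)` and `∂G_l/∂s (t₀, s)` have a common
complex zero `s`. -/
def setS2 (G : ℝ[X][X][X]) (t₀ : ℝ) : Set ℝ :=
  {l | l ≠ 0 ∧ ∃ s : ℂ,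
    Polynomial.aeval s ((atT G t₀).map (Polynomial.evalRingHom l)) = 0 ∧
    Polynomial.aeval s ((atT (partialS G) t₀).map (Polynomial.evalRingHom l)) = 0}

/-- `M = G_s² G_tt - 2 G_t G_s G_ts + G_t² G_ss` at `(t₀, s₀)`, a polynomial in `ℝ[l][s₀]`. -/
def coeffM (G : ℝ[X][X][X]) (t₀ : ℝ) : ℝ[X][X] :=
  atT (partialS G ^ 2 * partialT (partialT G)
    - 2 * partialT G * partialS G * partialS (partialT G)
    + partialT G ^ 2 * partialS (partialS G)) t₀

/-- The constant `t₀` in `ℝ[l][s₀]`. -/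
def constT (t₀ : ℝ) : ℝ[X][X] := Polynomial.C (Polynomial.C t₀)

/-- `a = - M s₀ - 2 G_t² G_s` in `ℝ[l][s₀]`; the variable `s₀` is the outer one. -/
def coeffA (G : ℝ[X][X][X]) (t₀ : ℝ) : ℝ[X][X] :=
  - coeffM G t₀ * Polynomial.X - 2 * atT (partialT G) t₀ ^ 2 * atT (partialS G) t₀

/-- `b = M t₀ s₀ + 2 s₀ G_t G_s² + 2 t₀ G_t² G_s`. -/
def coeffB (G : ℝ[X][X][X]) (t₀ : ℝ) : ℝ[X][X] :=
  coeffM G t₀ * constT t₀ * Polynomial.X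
    + 2 * Polynomial.X * atT (partialT G) t₀ * atT (partialS G) t₀ ^ 2
    + 2 * constT t₀ * atT (partialT G) t₀ ^ 2 * atT (partialS G) t₀

/-- `c = - M`. -/
def coeffC (G : ℝ[X][X][X]) (t₀ : ℝ) : ℝ[X][X] := - coeffM G t₀

/-- `d = M t₀ + 2 G_t G_s²`. -/
def coeffD (G : ℝ[X][X][X]) (t₀ : ℝ) : ℝ[X][X] :=
  coeffM G t₀ * constT t₀ + 2 * atT (partialT G) t₀ * atT (partialS G) t₀ ^ 2

/-- `P(t) = (c t + d)ⁿ G(t, (a t + b) / (c t + d))` with `n` the degree of `G` in `s`: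
the result of clearing denominators. It is a polynomial in `t` over `ℝ[l][s₀]`. -/
def polyP (G : ℝ[X][X][X]) (t₀ : ℝ) : ℝ[X][X][X] :=
  ∑ i ∈ Finset.range (G.natDegree + 1),
    (G.coeff i).map Polynomial.C *
      (Polynomial.C (coeffA G t₀) * Polynomial.X + Polynomial.C (coeffB G t₀)) ^ i *
      (Polynomial.C (coeffC G t₀) * Polynomial.X + Polynomial.C (coeffD G t₀)) ^
        (G.natDegree - i)

/-- The ideal of `ℝ[l][s₀]` generated by the coefficients `Pᵢ(s₀, l)` of `P`. -/
def idealP (G : ℝ[X][X][X]) (t₀ : ℝ) : Ideal ℝ[X][X] :=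
  Ideal.span (Set.range fun i => (polyP G t₀).coeff i)

/-- The elimination ideal `⟨Pᵢ⟩ ∩ ℝ[l]`. -/
def elimIdeal (G : ℝ[X][X][X]) (t₀ : ℝ) : Ideal ℝ[X] :=
  (idealP G t₀).comap Polynomial.C

/-- `Λ(l)`, a generator of the elimination ideal. -/
def polyLambda (G : ℝ[X][X][X]) (t₀ : ℝ) : ℝ[X] :=
  Submodule.IsPrincipal.generator (elimIdeal G t₀)

/-- `S₀`: the nonzero real roots of `Λ`. -/
def setS0 (G : ℝ[X][X][X]) (t₀ : ℝ) : Set ℝ :=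
  {l | l ≠ 0 ∧ (polyLambda G t₀).eval l = 0}

end SimilarCurves

end

open scoped Polynomial Matrix

noncomputable section

namespace SimilarCurves

/-! ### The derivation of `ℝ(t)` -/

/-! A similarity between proper curves lifts to the parameters: equal vanishing ideals give an
ℝ-embedding `σ` of ℝ(t) sending `x₂` to `r Q x₁ + b`. Properness of `x₁` makes `σ` surjective, so φ
= `σ X` is a Möbius map p/q. Curvature and torsion are invariant under reparametrization and scale
by 1/r, so T vanishes at λ = r, s = φ(t).

Helicity gives κᵢ² = μᵢ²τᵢ², and the similarity forces μ₁² = μ₂² = μ². In lowest terms K = μ²(C₁D₂ −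
λC₂D₁)(C₁D₂ + λC₂D₁), so T divides K, hence G, and G also vanishes along the graph of φ
(`exists_mobius`).

If q(t₀) = 0, clearing denominators in G(t, φ(t)) = 0 at t₀ leaves only the leading term, so L(r) =
0. Otherwise take s₀ = φ(t₀). A Möbius map is determined by its 2-jet, and implicit differentiation
of G expresses the 2-jet at t₀; this is the origin of a, b, c, d. By `exists_eval_coeffs_eq` they
equal k times the coefficients of φ, so P specializes to kⁿ times the cleared form of G(t, φ(t)),
which is zero. A multiple root at s₀ only makes k = 0 and needs no separate treatment. Thus all Pᵢ
vanish at (s₀, r), and so does Λ. -/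

theorem ratDeriv_div (p : ℝ[X]) {q : ℝ[X]} (hq : q ≠ 0) :
    ratDeriv (algebraMap ℝ[X] (RatFunc ℝ) p / algebraMap ℝ[X] (RatFunc ℝ) q) =
      algebraMap ℝ[X] (RatFunc ℝ)
        (Polynomial.derivative p * q - p * Polynomial.derivative q) /
        algebraMap ℝ[X] (RatFunc ℝ) (q ^ 2) := by
  obtain ⟨x, hx⟩ : ∃ x, x = algebraMap ℝ[X] (RatFunc ℝ) p / algebraMap ℝ[X] (RatFunc ℝ) q :=
    ⟨_, rfl⟩
  have hd := RatFunc.denom_ne_zero x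
  have h : x.num * q = p * x.denom := (RatFunc.num_mul_eq_mul_denom_iff hq).2 hx
  have h' := congrArg Polynomial.derivative h
  rw [Polynomial.derivative_mul, Polynomial.derivative_mul] at h'
  rw [← hx, ratDeriv, div_eq_div_iff (RatFunc.algebraMap_ne_zero (pow_ne_zero 2 hd))
    (RatFunc.algebraMap_ne_zero (pow_ne_zero 2 hq)), ← map_mul, ← map_mul]
  refine congrArg _ ?_
  -- The quotient rule is independent of the representation: eliminate between the cross-multiplied
  -- identity and its derivative.
  linear_combination x.denom * q * h' -
    (q * Polynomial.derivative x.denom + x.denom * Polynomial.derivative q) * h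

theorem ratDeriv_algebraMap (p : ℝ[X]) :
    ratDeriv (algebraMap ℝ[X] (RatFunc ℝ) p) =
      algebraMap ℝ[X] (RatFunc ℝ) (Polynomial.derivative p) := by
  have := ratDeriv_div p one_ne_zero
  simpa using this

theorem exists_eq_div (x : RatFunc ℝ) : ∃ p q : ℝ[X], q ≠ 0 ∧
    x = algebraMap ℝ[X] (RatFunc ℝ) p / algebraMap ℝ[X] (RatFunc ℝ) q :=
  ⟨x.num, x.denom, x.denom_ne_zero, (RatFunc.num_div_denom x).symm⟩

theorem ratDeriv_add (x y : RatFunc ℝ) : ratDeriv (x + y) = ratDeriv x + ratDeriv y := by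
  obtain ⟨a, b, hb, rfl⟩ := exists_eq_div x
  obtain ⟨c, d, hd, rfl⟩ := exists_eq_div y
  have hb' := RatFunc.algebraMap_ne_zero hb
  have hd' := RatFunc.algebraMap_ne_zero hd
  rw [div_add_div _ _ hb' hd', ← map_mul, ← map_mul, ← map_mul, ← map_add,
    ratDeriv_div _ (mul_ne_zero hb hd), ratDeriv_div _ hb, ratDeriv_div _ hd]
  simp only [map_mul, map_add, map_sub, map_pow, Polynomial.derivative_mul]
  field_simp
  ring

theorem ratDeriv_mul (x y : RatFunc ℝ) :
    ratDeriv (x * y) = x * ratDeriv y + y * ratDeriv x := by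
  obtain ⟨a, b, hb, rfl⟩ := exists_eq_div x
  obtain ⟨c, d, hd, rfl⟩ := exists_eq_div y
  have hb' := RatFunc.algebraMap_ne_zero hb
  have hd' := RatFunc.algebraMap_ne_zero hd
  rw [div_mul_div_comm, ← map_mul, ← map_mul,
    ratDeriv_div _ (mul_ne_zero hb hd), ratDeriv_div _ hb, ratDeriv_div _ hd]
  simp only [map_mul, map_add, map_sub, map_pow, Polynomial.derivative_mul]
  field_simp
  ring

theorem ratDeriv_C (c : ℝ) : ratDeriv (RatFunc.C c) = 0 := by
  rw [← RatFunc.algebraMap_C, ratDeriv_algebraMap]; simp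

/-- `ratDeriv` as a derivation of the field `ℝ(t)`. -/
def ratDerivation : Derivation ℝ (RatFunc ℝ) (RatFunc ℝ) :=
  Derivation.mk'
    { toFun := ratDeriv
      map_add' := ratDeriv_add
      map_smul' := fun c x => by
        rw [RatFunc.smul_eq_C_mul, ratDeriv_mul, ratDeriv_C, RingHom.id_apply,
          RatFunc.smul_eq_C_mul]; ring }
    fun x y => ratDeriv_mul x y

theorem ratDerivation_apply (x : RatFunc ℝ) : ratDerivation x = ratDeriv x := rfl

/-- By coprimality the denominator divides its own derivative, which has smaller degree and so is
zero; then the numerator is constant too. -/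
theorem eq_C_of_ratDeriv_eq_zero {x : RatFunc ℝ} (h : ratDeriv x = 0) :
    ∃ c, x = RatFunc.C c := by
  have hd := RatFunc.denom_ne_zero x
  rw [ratDeriv, div_eq_zero_iff,
    or_iff_left (RatFunc.algebraMap_ne_zero (pow_ne_zero 2 hd)),
    map_eq_zero_iff _ (RatFunc.algebraMap_injective ℝ)] at h
  have hdvd : x.denom ∣ Polynomial.derivative x.denom := by
    refine (RatFunc.isCoprime_num_denom x).symm.dvd_of_dvd_mul_left ?_
    exact ⟨Polynomial.derivative x.num, by linear_combination -h⟩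
  have hd0 : Polynomial.derivative x.denom = 0 := by
    by_contra hne
    exact absurd (Polynomial.degree_le_of_dvd hdvd hne)
      (not_le.2 (Polynomial.degree_derivative_lt hd))
  have hn0 : Polynomial.derivative x.num = 0 := by
    rw [hd0, mul_zero, sub_zero] at h
    exact (mul_eq_zero.1 h).resolve_right hd
  refine ⟨x.num.coeff 0 / x.denom.coeff 0, ?_⟩
  conv_lhs => rw [← RatFunc.num_div_denom x, Polynomial.eq_C_of_derivative_eq_zero hn0,
    Polynomial.eq_C_of_derivative_eq_zero hd0]
  simp

/-- Differentiation of a composite rational function. -/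
theorem ratDeriv_algHom (σ : RatFunc ℝ →ₐ[ℝ] RatFunc ℝ) (x : RatFunc ℝ) :
    ratDeriv (σ x) = ratDeriv (σ RatFunc.X) * σ (ratDeriv x) := by
  have hpoly : ∀ p : ℝ[X], ratDeriv (σ (algebraMap ℝ[X] (RatFunc ℝ) p)) =
      ratDeriv (σ RatFunc.X) * σ (algebraMap ℝ[X] (RatFunc ℝ) (Polynomial.derivative p)) := by
    intro p
    induction p using Polynomial.induction_on' with
    | add p q hp hq => simp only [map_add, ratDeriv_add, hp, hq]; ring
    | monomial n a =>
      rw [Polynomial.derivative_monomial, RatFunc.algebraMap_monomial,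
        RatFunc.algebraMap_monomial]
      have hC : ∀ c : ℝ, σ (RatFunc.C c) = RatFunc.C c := fun c => σ.commutes c
      rw [map_mul, map_mul, map_pow, map_pow, hC, hC, ratDeriv_mul, ratDeriv_C,
        ← ratDerivation_apply, Derivation.leibniz_pow, ratDerivation_apply]
      simp only [map_mul, map_natCast, smul_eq_mul, nsmul_eq_mul]
      ring
  obtain ⟨a, b, hb, rfl⟩ := exists_eq_div x
  have hb' := RatFunc.algebraMap_ne_zero hb
  have hσ : σ (algebraMap ℝ[X] (RatFunc ℝ) b) ≠ 0 := (map_ne_zero σ).2 hb'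
  rw [← ratDerivation_apply, map_div₀, Derivation.leibniz_div, ratDerivation_apply,
    ratDerivation_apply, hpoly, hpoly, ratDeriv_div _ hb]
  simp only [map_div₀, map_mul, map_sub, map_pow, smul_eq_mul]
  field_simp

/-! ### Evaluation of rational functions at almost all parameters -/

theorem eventually_denom_ne_zero (x : RatFunc ℝ) :
    ∀ᶠ t in Filter.cofinite, x.denom.eval t ≠ 0 := by
  have := Polynomial.finite_setOfPred_isRoot x.denom_ne_zero
  simpa [Filter.eventually_cofinite, Polynomial.IsRoot] using this

theorem eval_add_of_denom {x y : RatFunc ℝ} {t : ℝ} (hx : x.denom.eval t ≠ 0)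
    (hy : y.denom.eval t ≠ 0) :
    (x + y).eval (RingHom.id ℝ) t = x.eval (RingHom.id ℝ) t + y.eval (RingHom.id ℝ) t :=
  RatFunc.eval_add _ _ hx hy

theorem eval_mul_of_denom {x y : RatFunc ℝ} {t : ℝ} (hx : x.denom.eval t ≠ 0)
    (hy : y.denom.eval t ≠ 0) :
    (x * y).eval (RingHom.id ℝ) t = x.eval (RingHom.id ℝ) t * y.eval (RingHom.id ℝ) t :=
  RatFunc.eval_mul _ _ hx hy

theorem denom_eval_ne_zero_of_dvd {x y z : RatFunc ℝ} {t : ℝ} (h : z.denom ∣ x.denom * y.denom)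
    (hx : x.denom.eval t ≠ 0) (hy : y.denom.eval t ≠ 0) : z.denom.eval t ≠ 0 := by
  intro h0
  obtain ⟨w, hw⟩ := h
  have := congrArg (Polynomial.eval t) hw
  rw [Polynomial.eval_mul, Polynomial.eval_mul, h0, zero_mul] at this
  exact mul_ne_zero hx hy this

theorem eventually_eval_ne_zero {x : RatFunc ℝ} (hx : x ≠ 0) :
    ∀ᶠ t in Filter.cofinite, x.eval (RingHom.id ℝ) t ≠ 0 := by
  have h := Polynomial.finite_setOfPred_isRoot (RatFunc.num_ne_zero hx)
  have h' : ∀ᶠ t in Filter.cofinite, x.num.eval t ≠ 0 := by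
    simpa [Filter.eventually_cofinite, Polynomial.IsRoot] using h
  filter_upwards [h', eventually_denom_ne_zero x] with t h1 h2
  exact div_ne_zero h1 h2

/-- A nonzero rational function has finitely many zeros and poles. This lifts pointwise identities
to ℝ(t). -/
theorem eq_zero_of_eventually_eval {x : RatFunc ℝ}
    (h : ∀ᶠ t in Filter.cofinite, x.eval (RingHom.id ℝ) t = 0) : x = 0 := by
  by_contra hx
  obtain ⟨t, h1, h2⟩ := (h.and (eventually_eval_ne_zero hx)).exists
  exact h2 h1

theorem eventually_eval_add (x y : RatFunc ℝ) : ∀ᶠ t in Filter.cofinite,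
    (x + y).eval (RingHom.id ℝ) t = x.eval (RingHom.id ℝ) t + y.eval (RingHom.id ℝ) t := by
  filter_upwards [eventually_denom_ne_zero x, eventually_denom_ne_zero y] with t hx hy
  exact eval_add_of_denom hx hy

theorem eventually_eval_mul (x y : RatFunc ℝ) : ∀ᶠ t in Filter.cofinite,
    (x * y).eval (RingHom.id ℝ) t = x.eval (RingHom.id ℝ) t * y.eval (RingHom.id ℝ) t := by
  filter_upwards [eventually_denom_ne_zero x, eventually_denom_ne_zero y] with t hx hy
  exact eval_mul_of_denom hx hy

theorem eval_C_mul (c : ℝ) (x : RatFunc ℝ) : ∀ᶠ t in Filter.cofinite,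
    (RatFunc.C c * x).eval (RingHom.id ℝ) t = c * x.eval (RingHom.id ℝ) t := by
  filter_upwards [eventually_eval_mul (RatFunc.C c) x] with t h
  rw [h, RatFunc.eval_C, RingHom.id_apply]

theorem eventually_eval_sub (x y : RatFunc ℝ) : ∀ᶠ t in Filter.cofinite,
    (x - y).eval (RingHom.id ℝ) t = x.eval (RingHom.id ℝ) t - y.eval (RingHom.id ℝ) t := by
  filter_upwards [eventually_eval_add (x - y) y] with t h
  rw [sub_add_cancel] at h
  linarith

theorem eventually_eval_pow (x : RatFunc ℝ) (n : ℕ) : ∀ᶠ t in Filter.cofinite,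
    (x ^ n).eval (RingHom.id ℝ) t = x.eval (RingHom.id ℝ) t ^ n := by
  induction n with
  | zero => simp
  | succ n ih =>
    filter_upwards [ih, eventually_eval_mul (x ^ n) x] with t h1 h2
    rw [pow_succ, h2, h1, pow_succ]

theorem eventually_eval_div (x y : RatFunc ℝ) : ∀ᶠ t in Filter.cofinite,
    (x / y).eval (RingHom.id ℝ) t = x.eval (RingHom.id ℝ) t / y.eval (RingHom.id ℝ) t := by
  by_cases hy : y = 0
  -- Division by zero gives zero on both sides.
  · simp [hy]
  filter_upwards [eventually_eval_mul (x / y) y, eventually_eval_ne_zero hy] with t h1 h2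
  rw [div_mul_cancel₀ _ hy] at h1
  rw [h1, mul_div_cancel_right₀ _ h2]

theorem eventually_eval_dotProduct (v w : Param) : ∀ᶠ t in Filter.cofinite,
    (v ⬝ᵥ w).eval (RingHom.id ℝ) t = v.point t ⬝ᵥ w.point t := by
  filter_upwards [eventually_eval_mul (v 0) (w 0), eventually_eval_mul (v 1) (w 1),
    eventually_eval_mul (v 2) (w 2), eventually_eval_add (v 0 * w 0) (v 1 * w 1),
    eventually_eval_add (v 0 * w 0 + v 1 * w 1) (v 2 * w 2)] with t h0 h1 h2 h3 h4
  simp only [dotProduct, Fin.sum_univ_three, Param.point, h0, h1, h2, h3, h4]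

theorem eventually_point_cross (v w : Param) : ∀ᶠ t in Filter.cofinite,
    Param.point (v ⨯₃ w) t = v.point t ⨯₃ w.point t := by
  have key : ∀ a b c d : RatFunc ℝ, ∀ᶠ t in Filter.cofinite,
      (a * b - c * d).eval (RingHom.id ℝ) t = a.eval (RingHom.id ℝ) t * b.eval (RingHom.id ℝ) t -
        c.eval (RingHom.id ℝ) t * d.eval (RingHom.id ℝ) t := by
    intro a b c d
    filter_upwards [eventually_eval_mul a b, eventually_eval_mul c d,
      eventually_eval_sub (a * b) (c * d)] with t h1 h2 h3
    rw [h3, h1, h2]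
  filter_upwards [key (v 1) (w 2) (v 2) (w 1), key (v 2) (w 0) (v 0) (w 2),
    key (v 0) (w 1) (v 1) (w 0)] with t h0 h1 h2
  ext i
  fin_cases i
  · simpa [Param.point, cross_apply] using h0
  · simpa [Param.point, cross_apply] using h1
  · simpa [Param.point, cross_apply] using h2

/-- `ℝ(t)` is formally real. -/
theorem eq_zero_of_dotProduct_self {v : Param} (h : v ⬝ᵥ v = 0) : v = 0 := by
  funext i
  refine eq_zero_of_eventually_eval ?_
  filter_upwards [eventually_eval_dotProduct v v] with t ht
  rw [h, RatFunc.eval_zero] at ht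
  exact congrFun (dotProduct_self_eq_zero.1 ht.symm) i

/-! ### The vanishing ideal of a parametrized curve -/

theorem denom_C_eval (c t : ℝ) : (RatFunc.C c).denom.eval t ≠ 0 := by simp

theorem eval_aeval_of_definedAt {x : Param} {t : ℝ} (ht : x.DefinedAt t)
    (q : MvPolynomial (Fin 3) ℝ) :
    (MvPolynomial.aeval x q).denom.eval t ≠ 0 ∧
      (MvPolynomial.aeval x q).eval (RingHom.id ℝ) t = MvPolynomial.eval (x.point t) q := by
  induction q using MvPolynomial.induction_on with
  | C a =>
    rw [MvPolynomial.aeval_C, RatFunc.algebraMap_eq_C, RatFunc.eval_C, MvPolynomial.eval_C]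
    exact ⟨denom_C_eval a t, rfl⟩
  | add p q hp hq =>
    rw [map_add, map_add, eval_add_of_denom hp.1 hq.1, hp.2, hq.2]
    exact ⟨denom_eval_ne_zero_of_dvd (RatFunc.denom_add_dvd _ _) hp.1 hq.1, rfl⟩
  | mul_X p i hp =>
    rw [map_mul, map_mul, MvPolynomial.aeval_X, MvPolynomial.eval_X,
      eval_mul_of_denom hp.1 (ht i), hp.2]
    exact ⟨denom_eval_ne_zero_of_dvd (RatFunc.denom_mul_dvd _ _) hp.1 (ht i), rfl⟩

theorem eventually_definedAt (x : Param) : ∀ᶠ t in Filter.cofinite, x.DefinedAt t :=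
  Filter.eventually_all.2 fun i => eventually_denom_ne_zero (x i)

theorem point_mem_curve {x : Param} {t : ℝ} (ht : x.DefinedAt t) : x.point t ∈ x.curve :=
  fun _ hq => hq t ht

/-- Passing to the Zariski closure adds no equations, so the ideal of the curve is the kernel of
substitution into ℝ(t). Equality of curves thereby becomes an algebraic statement. -/
theorem aeval_eq_zero_iff (x : Param) (q : MvPolynomial (Fin 3) ℝ) :
    MvPolynomial.aeval x q = 0 ↔ ∀ p ∈ x.curve, MvPolynomial.eval p q = 0 := by
  constructor
  · intro h p hp
    refine hp q fun t ht => ?_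
    rw [← (eval_aeval_of_definedAt ht q).2, h, RatFunc.eval_zero]
  · intro h
    refine eq_zero_of_eventually_eval ?_
    filter_upwards [eventually_definedAt x] with t ht
    rw [(eval_aeval_of_definedAt ht q).2]
    exact h _ (point_mem_curve ht)

/-! ### Nonplanar curves have nonzero torsion -/

theorem ratDeriv_dotProduct (v w : Param) :
    ratDeriv (v ⬝ᵥ w) = v.deriv ⬝ᵥ w + v ⬝ᵥ w.deriv := by
  simp only [dotProduct, Fin.sum_univ_three, ratDeriv_add, ratDeriv_mul, Param.deriv]
  ring

/-- Wronskian descent: normalize one coordinate of `n` to 1. Either the result is constant, or its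
derivative is a nonzero vector with smaller support, still orthogonal to one derivative fewer by the
Leibniz rule. -/
theorem exists_const_of_dotProduct_iterate_deriv (v : Param) (k : ℕ) :
    ∀ (S : Finset (Fin 3)) (n : Param), S.card = k → n ≠ 0 → (∀ i ∉ S, n i = 0) →
      (∀ j < k, n ⬝ᵥ (Param.deriv^[j] v) = 0) →
      ∃ c : Fin 3 → ℝ, c ≠ 0 ∧ (fun i => RatFunc.C (c i)) ⬝ᵥ v = 0 := by
  induction k with
  | zero =>
    intro S n hS hn hnS _
    rw [Finset.card_eq_zero] at hS
    exact absurd (funext fun i => hnS i (by simp [hS])) hn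
  | succ k ih =>
    intro S n hS hn hnS h
    obtain ⟨j, hj⟩ := Function.ne_iff.1 hn
    have hj0 : n j ≠ 0 := hj
    have hjS : j ∈ S := by
      by_contra hjS
      exact hj0 (hnS j hjS)
    let m : Param := (n j)⁻¹ • n
    have hm : ∀ i < k + 1, m ⬝ᵥ (Param.deriv^[i] v) = 0 := fun i hi => by
      rw [smul_dotProduct, h i hi, smul_zero]
    have hmj : m j = 1 := inv_mul_cancel₀ hj0
    by_cases hm0 : m.deriv = 0
    · choose c hc using fun i => eq_C_of_ratDeriv_eq_zero (congrFun hm0 i)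
      refine ⟨c, fun h0 => ?_, ?_⟩
      · have := hc j
        rw [hmj, h0] at this
        simp at this
      · rw [← funext hc]
        exact hm 0 k.succ_pos
    · refine ih (S.erase j) m.deriv ?_ hm0 ?_ ?_
      · rw [Finset.card_erase_of_mem hjS, hS, Nat.add_sub_cancel]
      · intro i hi
        by_cases hij : i = j
        · have := ratDeriv_C 1
          rw [map_one] at this
          rw [hij, Param.deriv, hmj, this]
        · have : m i = 0 := by
            simp [m, hnS i fun hiS => hi (Finset.mem_erase.2 ⟨hij, hiS⟩)]
          rw [Param.deriv, this]
          exact map_zero ratDerivation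
      · intro i hi
        have h1 := ratDeriv_dotProduct m (Param.deriv^[i] v)
        rw [hm i (by omega), ← Function.iterate_succ_apply' Param.deriv, hm (i + 1) (by omega),
          add_zero] at h1
        rw [← h1]
        exact map_zero ratDerivation

theorem IsNonplanar.triple_product_ne_zero {x : Param} (hx : x.IsNonplanar) :
    (x.deriv ⨯₃ x.deriv.deriv) ⬝ᵥ x.deriv.deriv.deriv ≠ 0 := by
  intro h
  have hdet : (Matrix.of ![x.deriv.deriv.deriv, x.deriv, x.deriv.deriv]).det = 0 := by
    rw [dotProduct_comm, triple_product_eq_det] at h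
    exact h
  obtain ⟨n, hn, hn0⟩ := Matrix.exists_mulVec_eq_zero_iff.2 hdet
  have e0 : x.deriv.deriv.deriv ⬝ᵥ n = 0 := congrFun hn0 0
  have e1 : x.deriv ⬝ᵥ n = 0 := congrFun hn0 1
  have e2 : x.deriv.deriv ⬝ᵥ n = 0 := congrFun hn0 2
  obtain ⟨c, hc, hcx⟩ := exists_const_of_dotProduct_iterate_deriv x.deriv 3 Finset.univ n
    (by simp) hn (by simp) (by
      intro j hj
      rw [dotProduct_comm]
      interval_cases j
      · exact e1
      · exact e2
      · exact e0)
  have hD : ratDeriv ((fun i => RatFunc.C (c i)) ⬝ᵥ x) = 0 := by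
    have h0 : Param.deriv (fun i => RatFunc.C (c i)) = 0 := funext fun i => ratDeriv_C (c i)
    rw [ratDeriv_dotProduct, h0, zero_dotProduct, zero_add, hcx]
  obtain ⟨d, hd⟩ := eq_C_of_ratDeriv_eq_zero hD
  refine hx ⟨c, d, hc, fun p hp => ?_⟩
  have hq := (aeval_eq_zero_iff x
    (∑ i, MvPolynomial.C (c i) * MvPolynomial.X i - MvPolynomial.C d)).1 (by
      simp only [map_sub, map_sum, map_mul, MvPolynomial.aeval_X, MvPolynomial.aeval_C,
        RatFunc.algebraMap_eq_C]
      rw [← hd, dotProduct, sub_self]) p hp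
  simp only [map_sub, map_sum, map_mul, MvPolynomial.eval_X, MvPolynomial.eval_C] at hq
  exact sub_eq_zero.1 hq

theorem IsNonplanar.torsion_ne_zero {x : Param} (hx : x.IsNonplanar) : x.torsion ≠ 0 := by
  have h := IsNonplanar.triple_product_ne_zero hx
  refine div_ne_zero h fun h0 => h ?_
  rw [eq_zero_of_dotProduct_self h0, zero_dotProduct]

theorem IsHelical.exists_curvatureSq_eq {x : Param} (hx : x.IsHelical) :
    ∃ μ : ℝ, x.curvatureSq = RatFunc.C (μ ^ 2) * x.torsion ^ 2 := by
  obtain ⟨hx, μ, hμ⟩ := hx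
  have hs : ∀ v : Fin 3 → ℝ, √(v ⬝ᵥ v) ^ 2 = v ⬝ᵥ v := fun v =>
    Real.sq_sqrt (Finset.sum_nonneg fun i _ => mul_self_nonneg _)
  refine ⟨μ, sub_eq_zero.1 (eq_zero_of_eventually_eval ?_)⟩
  filter_upwards [hμ, eventually_eval_ne_zero (IsNonplanar.torsion_ne_zero hx),
    eventually_eval_pow x.torsion 2, eval_C_mul (μ ^ 2) (x.torsion ^ 2),
    eventually_eval_sub x.curvatureSq (RatFunc.C (μ ^ 2) * x.torsion ^ 2),
    eventually_eval_div ((x.deriv ⨯₃ x.deriv.deriv) ⬝ᵥ (x.deriv ⨯₃ x.deriv.deriv))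
      ((x.deriv ⬝ᵥ x.deriv) ^ 3),
    eventually_eval_pow (x.deriv ⬝ᵥ x.deriv) 3,
    eventually_eval_dotProduct x.deriv x.deriv,
    eventually_eval_dotProduct (x.deriv ⨯₃ x.deriv.deriv) (x.deriv ⨯₃ x.deriv.deriv),
    eventually_point_cross x.deriv x.deriv.deriv] with t h1 h2 h3 h4 h5 h6 h7 h8 h9 h10
  rw [h5, h4, h3, Param.curvatureSq, h6, h7, h8, h9, h10, sub_eq_zero, ← mul_pow, ← h1,
    div_mul_cancel₀ _ h2, Param.curvature, div_pow, ← pow_mul, mul_comm 3 2, pow_mul,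
    hs, hs]

/-! ### Similar proper curves have parametrizations related by a Möbius map -/

/-- Equal kernels make `x i ↦ y i` a well-defined injection on ℝ[x]; properness says that ℝ(t) is
the fraction field of ℝ[x], so it extends. -/
theorem exists_algHom_of_aeval_eq_zero_iff {x y : Param} (hx : x.IsProper)
    (h : ∀ q : MvPolynomial (Fin 3) ℝ, MvPolynomial.aeval x q = 0 ↔ MvPolynomial.aeval y q = 0) :
    ∃ σ : RatFunc ℝ →ₐ[ℝ] RatFunc ℝ, ∀ i, σ (x i) = y i := by
  let ev : MvPolynomial (Fin 3) ℝ →ₐ[ℝ] RatFunc ℝ := MvPolynomial.aeval x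
  have hfrac : IsFractionRing ev.range (RatFunc ℝ) := by
    refine IsFractionRing.of_field _ _ fun z => ?_
    have hz : z ∈ IntermediateField.adjoin ℝ (Set.range x) := by
      rw [show IntermediateField.adjoin ℝ (Set.range x) = ⊤ from hx]
      trivial
    obtain ⟨p, q, hpq⟩ := (IntermediateField.mem_adjoin_range_iff ℝ x z).1 hz
    exact ⟨⟨ev p, p, rfl⟩, ⟨ev q, q, rfl⟩, hpq⟩
  let g : ev.range →ₐ[ℝ] RatFunc ℝ :=
    AlgHom.liftOfSurjective ev.rangeRestrict ev.rangeRestrict_surjective (MvPolynomial.aeval y)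
      (fun q hq => (h q).1 (congrArg Subtype.val hq))
  have hg : ∀ q, g (ev.rangeRestrict q) = MvPolynomial.aeval y q := fun q =>
    AlgHom.liftOfSurjective_apply _ _ _ _ q
  have hinj : Function.Injective g := by
    rw [injective_iff_map_eq_zero]
    intro a ha
    obtain ⟨q, rfl⟩ := ev.rangeRestrict_surjective a
    rw [hg] at ha
    exact Subtype.ext ((h q).2 ha)
  refine ⟨IsFractionRing.liftAlgHom hinj, fun i => ?_⟩
  have h1 := hg (MvPolynomial.X i)
  have h2 : x i = algebraMap ev.range (RatFunc ℝ) (ev.rangeRestrict (MvPolynomial.X i)) :=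
    (MvPolynomial.aeval_X x i).symm
  rw [h2, IsFractionRing.liftAlgHom_apply, IsFractionRing.lift_algebraMap]
  rw [MvPolynomial.aeval_X] at h1
  exact h1

/-- The parametrization `r Q x + b`. -/
def Param.similar (x : Param) (r : ℝ) (Q : Matrix (Fin 3) (Fin 3) ℝ) (b : Fin 3 → ℝ) : Param :=
  RatFunc.C r • (Q.map RatFunc.C *ᵥ x) + fun i => RatFunc.C (b i)

theorem aeval_similar_eq_zero_iff {x₁ x₂ : Param} {f : (Fin 3 → ℝ) → (Fin 3 → ℝ)}
    (hfC : f '' x₁.curve = x₂.curve) {r : ℝ} {Q : Matrix (Fin 3) (Fin 3) ℝ} {b : Fin 3 → ℝ}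
    (hf : ∀ v, f v = r • (Q *ᵥ v) + b) (q : MvPolynomial (Fin 3) ℝ) :
    MvPolynomial.aeval x₂ q = 0 ↔ MvPolynomial.aeval (x₁.similar r Q b) q = 0 := by
  let F : Fin 3 → MvPolynomial (Fin 3) ℝ := fun i =>
    MvPolynomial.C r * ∑ j, MvPolynomial.C (Q i j) * MvPolynomial.X j + MvPolynomial.C (b i)
  have h1 : MvPolynomial.aeval x₁ (MvPolynomial.bind₁ F q) =
      MvPolynomial.aeval (x₁.similar r Q b) q := by
    rw [MvPolynomial.aeval_bind₁]
    congr 2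
    funext i
    simp [F, Param.similar, Matrix.mulVec, dotProduct, MvPolynomial.aeval_C,
      -MvPolynomial.algHom_C]
  have h2 : ∀ p, MvPolynomial.eval p (MvPolynomial.bind₁ F q) = MvPolynomial.eval (f p) q := by
    intro p
    rw [← MvPolynomial.aeval_eq_eval, ← MvPolynomial.aeval_eq_eval,
      MvPolynomial.aeval_bind₁]
    congr 2
    funext i
    simp [F, hf, Matrix.mulVec, dotProduct]
  rw [← h1, aeval_eq_zero_iff, aeval_eq_zero_iff, ← hfC, Set.forall_mem_image]
  simp only [h2]

theorem surjective_of_similar {x₁ x₂ : Param} (hp₁ : x₁.IsProper) {r : ℝ} (hr : r ≠ 0)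
    {Q : Matrix (Fin 3) (Fin 3) ℝ} (hQ : Qᵀ * Q = 1) {b : Fin 3 → ℝ}
    {σ : RatFunc ℝ →ₐ[ℝ] RatFunc ℝ} (hσ : ∀ i, σ (x₂ i) = x₁.similar r Q b i) :
    Function.Surjective σ := by
  have hC : ∀ c : ℝ, RatFunc.C c ∈ σ.fieldRange := fun c => σ.fieldRange.algebraMap_mem c
  have hx : ∀ i, x₁ i ∈ σ.fieldRange := by
    intro i
    have hQ' : (Q.map RatFunc.C)ᵀ * Q.map RatFunc.C = 1 := by
      rw [← Matrix.transpose_map, ← Matrix.map_mul, hQ, Matrix.map_one _ (map_zero _) (map_one _)]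
    have h1 : x₁ = RatFunc.C r⁻¹ • ((Q.map RatFunc.C)ᵀ *ᵥ
        (x₁.similar r Q b - fun i => RatFunc.C (b i))) := by
      rw [Param.similar, add_sub_cancel_right, Matrix.mulVec_smul, Matrix.mulVec_mulVec, hQ',
        Matrix.one_mulVec, smul_smul, ← map_mul, inv_mul_cancel₀ hr, map_one, one_smul]
    rw [h1]
    change RatFunc.C r⁻¹ *
      ∑ j, RatFunc.C (Q j i) * (x₁.similar r Q b j - RatFunc.C (b j)) ∈ σ.fieldRange
    refine mul_mem (hC _) (sum_mem fun j _ => mul_mem (hC _) (sub_mem ?_ (hC _)))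
    exact ⟨x₂ j, hσ j⟩
  intro z
  have hz : z ∈ IntermediateField.adjoin ℝ (Set.range x₁) := by
    rw [show IntermediateField.adjoin ℝ (Set.range x₁) = ⊤ from hp₁]
    trivial
  have hle : IntermediateField.adjoin ℝ (Set.range x₁) ≤ σ.fieldRange :=
    IntermediateField.adjoin_le_iff.2 (Set.range_subset_iff.2 hx)
  exact hle hz

/-- The degree of ℝ(t) over ℝ(z) is the larger of the degrees of numerator and denominator of z;
here it is 1. -/
theorem natDegree_map_X_le_one {σ : RatFunc ℝ →ₐ[ℝ] RatFunc ℝ} (hσ : Function.Surjective σ) :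
    (σ RatFunc.X).num.natDegree ≤ 1 ∧ (σ RatFunc.X).denom.natDegree ≤ 1 := by
  have htop : IntermediateField.adjoin ℝ {σ RatFunc.X} = ⊤ := by
    rw [← Set.image_singleton, ← IntermediateField.adjoin_map, RatFunc.adjoin_X]
    rw [← AlgHom.fieldRange_eq_map]
    exact AlgHom.fieldRange_eq_top.2 hσ
  have h := RatFunc.finrank_eq_max_natDegree (σ RatFunc.X)
  rw [htop, IntermediateField.finrank_top] at h
  exact ⟨h ▸ le_max_left _ _, h ▸ le_max_right _ _⟩

/-! ### Behaviour of curvature and torsion under similarities and reparametrizations -/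

theorem deriv_add (v w : Param) : Param.deriv (v + w) = v.deriv + w.deriv :=
  funext fun i => ratDeriv_add (v i) (w i)

theorem deriv_smul (g : RatFunc ℝ) (v : Param) :
    Param.deriv (g • v) = ratDeriv g • v + g • v.deriv := by
  funext i
  simp only [Param.deriv, Pi.smul_apply, Pi.add_apply, smul_eq_mul, ratDeriv_mul]
  ring

theorem deriv_mulVec (Q : Matrix (Fin 3) (Fin 3) ℝ) (v : Param) :
    Param.deriv (Q.map RatFunc.C *ᵥ v) = Q.map RatFunc.C *ᵥ v.deriv := by
  funext i
  simp only [Param.deriv, Matrix.mulVec, dotProduct, Fin.sum_univ_three, ratDeriv_add,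
    ratDeriv_mul, Matrix.map_apply, ratDeriv_C]
  ring

theorem deriv_C_smul_mulVec (r : ℝ) (Q : Matrix (Fin 3) (Fin 3) ℝ) (v : Param) :
    Param.deriv (RatFunc.C r • (Q.map RatFunc.C *ᵥ v)) =
      RatFunc.C r • (Q.map RatFunc.C *ᵥ v.deriv) := by
  rw [deriv_smul, ratDeriv_C, zero_smul, zero_add, deriv_mulVec]

theorem deriv_similar (x : Param) (r : ℝ) (Q : Matrix (Fin 3) (Fin 3) ℝ) (b : Fin 3 → ℝ) :
    (x.similar r Q b).deriv = RatFunc.C r • (Q.map RatFunc.C *ᵥ x.deriv) := by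
  have h0 : Param.deriv (fun i => RatFunc.C (b i)) = 0 := funext fun i => ratDeriv_C (b i)
  rw [Param.similar, deriv_add, h0, add_zero, deriv_C_smul_mulVec]

theorem deriv_comp (σ : RatFunc ℝ →ₐ[ℝ] RatFunc ℝ) (v : Param) :
    Param.deriv (σ ∘ v) = ratDeriv (σ RatFunc.X) • (σ ∘ v.deriv) :=
  funext fun i => ratDeriv_algHom σ (v i)

theorem dotProduct_mulVec_mulVec {R : Type*} [CommRing R] {M : Matrix (Fin 3) (Fin 3) R}
    (hM : Mᵀ * M = 1) (u v : Fin 3 → R) : (M *ᵥ u) ⬝ᵥ (M *ᵥ v) = u ⬝ᵥ v := by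
  rw [Matrix.dotProduct_mulVec, ← Matrix.mulVec_transpose, Matrix.mulVec_mulVec, hM,
    Matrix.one_mulVec]

theorem cross_dot_eq_det {R : Type*} [CommRing R] (u v w : Fin 3 → R) :
    (u ⨯₃ v) ⬝ᵥ w = (Matrix.of ![w, u, v]).det := by
  rw [dotProduct_comm, triple_product_eq_det]
  rfl

theorem cross_dot_mulVec {R : Type*} [CommRing R] (M : Matrix (Fin 3) (Fin 3) R)
    (u v w : Fin 3 → R) :
    ((M *ᵥ u) ⨯₃ (M *ᵥ v)) ⬝ᵥ (M *ᵥ w) = M.det * ((u ⨯₃ v) ⬝ᵥ w) := by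
  have h : Matrix.of ![M *ᵥ w, M *ᵥ u, M *ᵥ v] = Matrix.of ![w, u, v] * Mᵀ := by
    ext i j
    fin_cases i <;> simp [Matrix.mul_apply, Matrix.mulVec, dotProduct, mul_comm]
  rw [cross_dot_eq_det, cross_dot_eq_det, h, Matrix.det_mul, Matrix.det_transpose, mul_comm]

theorem curvatureSq_similar (x : Param) {r : ℝ} (hr : r ≠ 0) {Q : Matrix (Fin 3) (Fin 3) ℝ}
    (hQ : Qᵀ * Q = 1) (b : Fin 3 → ℝ) :
    x.curvatureSq = RatFunc.C r ^ 2 * (x.similar r Q b).curvatureSq := by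
  have hr' : RatFunc.C r ≠ 0 := (map_ne_zero _).2 hr
  have hQ' : (Q.map RatFunc.C)ᵀ * Q.map RatFunc.C = 1 := by
    rw [← Matrix.transpose_map, ← Matrix.map_mul, hQ, Matrix.map_one _ (map_zero _) (map_one _)]
  simp only [Param.curvatureSq, deriv_similar, deriv_C_smul_mulVec, cross_dot_cross,
    smul_dotProduct, dotProduct_smul, dotProduct_mulVec_mulVec hQ', smul_eq_mul]
  -- With a zero denominator both curvatures are zero by convention.
  by_cases h : x.deriv ⬝ᵥ x.deriv = 0
  · simp [h]
  field_simp

theorem torsion_similar (x : Param) {r : ℝ} (hr : r ≠ 0) {Q : Matrix (Fin 3) (Fin 3) ℝ}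
    (hQ : Qᵀ * Q = 1) (hdet : Q.det = 1) (b : Fin 3 → ℝ) :
    x.torsion = RatFunc.C r * (x.similar r Q b).torsion := by
  have hr' : RatFunc.C r ≠ 0 := (map_ne_zero _).2 hr
  have hQ' : (Q.map RatFunc.C)ᵀ * Q.map RatFunc.C = 1 := by
    rw [← Matrix.transpose_map, ← Matrix.map_mul, hQ, Matrix.map_one _ (map_zero _) (map_one _)]
  have hdet' : (Q.map RatFunc.C).det = 1 := by
    rw [← RingHom.mapMatrix_apply, ← RingHom.map_det, hdet, map_one]
  have h1 : ((x.similar r Q b).deriv ⨯₃ (x.similar r Q b).deriv.deriv) ⬝ᵥ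
      (x.similar r Q b).deriv.deriv.deriv =
        RatFunc.C r ^ 3 * ((x.deriv ⨯₃ x.deriv.deriv) ⬝ᵥ x.deriv.deriv.deriv) := by
    simp only [deriv_similar, deriv_C_smul_mulVec, map_smul, LinearMap.smul_apply,
      smul_dotProduct, dotProduct_smul, cross_dot_mulVec, hdet', smul_eq_mul]
    ring
  have h2 : ((x.similar r Q b).deriv ⨯₃ (x.similar r Q b).deriv.deriv) ⬝ᵥ
      ((x.similar r Q b).deriv ⨯₃ (x.similar r Q b).deriv.deriv) =
        RatFunc.C r ^ 4 * ((x.deriv ⨯₃ x.deriv.deriv) ⬝ᵥ (x.deriv ⨯₃ x.deriv.deriv)) := by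
    simp only [deriv_similar, deriv_C_smul_mulVec, cross_dot_cross,
      smul_dotProduct, dotProduct_smul, dotProduct_mulVec_mulVec hQ', smul_eq_mul]
    ring
  rw [Param.torsion, Param.torsion, h1, h2]
  by_cases h : (x.deriv ⨯₃ x.deriv.deriv) ⬝ᵥ (x.deriv ⨯₃ x.deriv.deriv) = 0
  · simp [h]
  field_simp

theorem dotProduct_comp (σ : RatFunc ℝ →ₐ[ℝ] RatFunc ℝ) (v w : Param) :
    (σ ∘ v) ⬝ᵥ (σ ∘ w) = σ (v ⬝ᵥ w) := by
  simp [dotProduct]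

theorem cross_comp (σ : RatFunc ℝ →ₐ[ℝ] RatFunc ℝ) (v w : Param) :
    (σ ∘ v : Param) ⨯₃ (σ ∘ w) = σ ∘ (v ⨯₃ w) := by
  funext i
  fin_cases i <;> simp [cross_apply]

/-! ### Invariance of curvature and torsion under change of parameter -/

section Reparametrization

variable (σ : RatFunc ℝ →ₐ[ℝ] RatFunc ℝ) (x : Param)

theorem deriv_deriv_comp : Param.deriv (Param.deriv (σ ∘ x)) =
    ratDeriv (ratDeriv (σ RatFunc.X)) • (σ ∘ x.deriv) +
      ratDeriv (σ RatFunc.X) ^ 2 • (σ ∘ x.deriv.deriv) := by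
  rw [deriv_comp, deriv_smul, deriv_comp, smul_smul, sq]

theorem cross_deriv_comp : Param.deriv (σ ∘ x) ⨯₃ Param.deriv (Param.deriv (σ ∘ x)) =
    ratDeriv (σ RatFunc.X) ^ 3 • (σ ∘ (x.deriv ⨯₃ x.deriv.deriv)) := by
  rw [deriv_deriv_comp, deriv_comp, map_add, map_smul, map_smul, map_smul, LinearMap.smul_apply,
    LinearMap.smul_apply, cross_self, smul_zero, smul_zero, zero_add, cross_comp, smul_smul,
    ← pow_succ]

theorem triple_product_comp : (Param.deriv (σ ∘ x) ⨯₃ Param.deriv (Param.deriv (σ ∘ x))) ⬝ᵥ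
      Param.deriv (Param.deriv (Param.deriv (σ ∘ x))) =
    ratDeriv (σ RatFunc.X) ^ 6 * σ ((x.deriv ⨯₃ x.deriv.deriv) ⬝ᵥ x.deriv.deriv.deriv) := by
  have h1 : (x.deriv ⨯₃ x.deriv.deriv) ⬝ᵥ x.deriv = 0 := by
    rw [dotProduct_comm, dot_self_cross]
  have h2 : (x.deriv ⨯₃ x.deriv.deriv) ⬝ᵥ x.deriv.deriv = 0 := by
    rw [dotProduct_comm, dot_cross_self]
  rw [cross_deriv_comp, deriv_deriv_comp, deriv_add, deriv_smul, deriv_smul, deriv_comp,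
    deriv_comp]
  simp only [smul_dotProduct, dotProduct_smul, dotProduct_add, dotProduct_comp, h1, h2, map_zero,
    smul_eq_mul]
  ring

variable {σ}

theorem curvatureSq_comp (hσ : ratDeriv (σ RatFunc.X) ≠ 0) :
    Param.curvatureSq (σ ∘ x) = σ x.curvatureSq := by
  rw [Param.curvatureSq, Param.curvatureSq, cross_deriv_comp, deriv_comp]
  simp only [smul_dotProduct, dotProduct_smul, dotProduct_comp, smul_eq_mul, map_div₀, map_pow]
  by_cases h : σ (x.deriv ⬝ᵥ x.deriv) = 0
  · simp [h]
  field_simp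

theorem torsion_comp (hσ : ratDeriv (σ RatFunc.X) ≠ 0) :
    Param.torsion (σ ∘ x) = σ x.torsion := by
  rw [Param.torsion, Param.torsion, triple_product_comp, cross_deriv_comp]
  simp only [smul_dotProduct, dotProduct_smul, dotProduct_comp, smul_eq_mul, map_div₀]
  by_cases h : σ ((x.deriv ⨯₃ x.deriv.deriv) ⬝ᵥ (x.deriv ⨯₃ x.deriv.deriv)) = 0
  · simp [h]
  field_simp

end Reparametrization

theorem ratDeriv_map_X_ne_zero {σ : RatFunc ℝ →ₐ[ℝ] RatFunc ℝ} (hσ : Function.Surjective σ) :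
    ratDeriv (σ RatFunc.X) ≠ 0 := by
  intro h
  obtain ⟨z, hz⟩ := hσ RatFunc.X
  have h1 := ratDeriv_algHom σ z
  rw [hz, h, zero_mul, ← RatFunc.algebraMap_X, ratDeriv_algebraMap, Polynomial.derivative_X,
    map_one] at h1
  exact one_ne_zero h1

/-! ### The greatest common divisor of `K` and `T` -/

/-- Squaring preserves coprimality, and monic denominators turn association into equality. -/
theorem num_denom_C_mul_sq {m : ℝ} (hm : m ≠ 0) {k τ : RatFunc ℝ}
    (h : k = RatFunc.C m * τ ^ 2) :
    k.num = Polynomial.C m * τ.num ^ 2 ∧ k.denom = τ.denom ^ 2 := by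
  have hd := RatFunc.denom_ne_zero τ
  have hd2 := pow_ne_zero 2 hd
  have hk : k = algebraMap ℝ[X] (RatFunc ℝ) (Polynomial.C m * τ.num ^ 2) /
      algebraMap ℝ[X] (RatFunc ℝ) (τ.denom ^ 2) := by
    conv_lhs => rw [h, ← RatFunc.num_div_denom τ]
    rw [map_mul, RatFunc.algebraMap_C, map_pow, map_pow, div_pow, mul_div_assoc]
  have hmul := (RatFunc.num_mul_eq_mul_denom_iff hd2).2 hk
  have hcop : IsCoprime (τ.denom ^ 2) (Polynomial.C m * τ.num ^ 2) :=
    (isCoprime_mul_unit_left_right (Polynomial.isUnit_C.2 hm.isUnit) _ _).2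
      (RatFunc.isCoprime_num_denom τ).symm.pow
  have h1 : τ.denom ^ 2 ∣ k.denom := hcop.dvd_of_dvd_mul_left ⟨k.num, by rw [← hmul, mul_comm]⟩
  have h2 : k.denom ∣ τ.denom ^ 2 := (RatFunc.denom_dvd hd2).2 ⟨_, hk⟩
  have h3 : k.denom = τ.denom ^ 2 :=
    Polynomial.eq_of_monic_of_associated (RatFunc.monic_denom k)
      ((RatFunc.monic_denom τ).pow 2) (associated_of_dvd_dvd h2 h1)
  refine ⟨?_, h3⟩
  rw [h3] at hmul
  exact mul_right_cancel₀ hd2 hmul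

theorem inT_mul (p q : ℝ[X]) : inT (p * q) = inT p * inT q := by simp [inT]

theorem inS_mul (p q : ℝ[X]) : inS (p * q) = inS p * inS q := by simp [inS]

theorem inT_pow (p : ℝ[X]) (n : ℕ) : inT (p ^ n) = inT p ^ n := by simp [inT]

theorem inS_pow (p : ℝ[X]) (n : ℕ) : inS (p ^ n) = inS p ^ n := by simp [inS, Polynomial.map_pow]

theorem inS_C (c : ℝ) : inS (Polynomial.C c) = inT (Polynomial.C c) := by simp [inS, inT]

/-- K is a difference of squares up to the factor `m`, and T is one of its two factors. -/
theorem polyT_dvd_polyK {x₁ x₂ : Param} {m : ℝ}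
    (h₁ : x₁.curvatureSq = RatFunc.C m * x₁.torsion ^ 2)
    (h₂ : x₂.curvatureSq = RatFunc.C m * x₂.torsion ^ 2) : polyT x₁ x₂ ∣ polyK x₁ x₂ := by
  by_cases hm : m = 0
  · rw [polyK, h₁, h₂, hm]
    simp only [inT, inS, map_zero, zero_mul, RatFunc.num_zero, Polynomial.map_zero, mul_zero]
    exact ⟨0, by ring⟩
  obtain ⟨hn₁, hd₁⟩ := num_denom_C_mul_sq hm h₁
  obtain ⟨hn₂, hd₂⟩ := num_denom_C_mul_sq hm h₂
  refine ⟨inT (Polynomial.C m) * (inT x₁.torsion.num * inS x₂.torsion.denom +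
    varL * inS x₂.torsion.num * inT x₁.torsion.denom), ?_⟩
  rw [polyK, polyT, hn₁, hd₁, hn₂, hd₂]
  simp only [inT_mul, inS_mul, inT_pow, inS_pow, inS_C]
  ring

/-- The evaluation `l ↦ r`, `t ↦ X`, `s ↦ z` from `ℝ[l][t][s]` to `ℝ(X)`. -/
def evalGraph (r : ℝ) (z : RatFunc ℝ) : ℝ[X][X][X] →+* RatFunc ℝ :=
  Polynomial.eval₂RingHom
    ((algebraMap ℝ[X] (RatFunc ℝ)).comp (Polynomial.mapRingHom (Polynomial.evalRingHom r))) z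

theorem evalGraph_inT (r : ℝ) (z : RatFunc ℝ) (p : ℝ[X]) :
    evalGraph r z (inT p) = algebraMap ℝ[X] (RatFunc ℝ) p := by
  have : (Polynomial.evalRingHom r).comp Polynomial.C = RingHom.id ℝ := by ext; simp
  simp [evalGraph, inT, Polynomial.map_map, this]

theorem evalGraph_inS (r : ℝ) (z : RatFunc ℝ) (p : ℝ[X]) :
    evalGraph r z (inS p) = Polynomial.aeval z p := by
  rw [evalGraph, inS, Polynomial.coe_eval₂RingHom, Polynomial.eval₂_map, Polynomial.aeval_def]
  congr 1
  ext c
  simp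

theorem evalGraph_varL (r : ℝ) (z : RatFunc ℝ) : evalGraph r z varL = RatFunc.C r := by
  simp [evalGraph, varL]

theorem map_algebraMap_eq_aeval (σ : RatFunc ℝ →ₐ[ℝ] RatFunc ℝ) (p : ℝ[X]) :
    σ (algebraMap ℝ[X] (RatFunc ℝ) p) = Polynomial.aeval (σ RatFunc.X) p := by
  rw [← RatFunc.aeval_X_left_eq_algebraMap, Polynomial.aeval_algHom_apply]

set_option maxSynthPendingDepth 10 in
theorem evalGraph_polyT {x₁ x₂ : Param} {r : ℝ} {σ : RatFunc ℝ →ₐ[ℝ] RatFunc ℝ}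
    (h : x₁.torsion = RatFunc.C r * σ x₂.torsion) :
    evalGraph r (σ RatFunc.X) (polyT x₁ x₂) = 0 := by
  rw [polyT, map_sub, map_mul, map_mul, map_mul, evalGraph_inT, evalGraph_inT, evalGraph_inS,
    evalGraph_inS, evalGraph_varL, ← map_algebraMap_eq_aeval, ← map_algebraMap_eq_aeval]
  have h1 := RatFunc.algebraMap_ne_zero x₁.torsion.denom_ne_zero
  have h2 : σ (algebraMap ℝ[X] (RatFunc ℝ) x₂.torsion.denom) ≠ 0 :=
    (map_ne_zero σ).2 (RatFunc.algebraMap_ne_zero x₂.torsion.denom_ne_zero)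
  have e1 := (eq_div_iff h1).1 (RatFunc.num_div_denom x₁.torsion).symm
  have e2 := (eq_div_iff h2).1
    ((congrArg σ (RatFunc.num_div_denom x₂.torsion)).symm.trans (map_div₀ σ _ _))
  rw [← e1, ← e2, h]
  ring

/-- The geometric input: `G` vanishes at `l = r` along the graph of a Möbius map. -/
theorem exists_mobius {x₁ x₂ : Param} (hp₁ : x₁.IsProper) (hp₂ : x₂.IsProper)
    (hh₁ : x₁.IsHelical) (hh₂ : x₂.IsHelical) {f : (Fin 3 → ℝ) → (Fin 3 → ℝ)} {r : ℝ}
    (hf : IsSimilarity f r) (hfC : f '' x₁.curve = x₂.curve) {G : ℝ[X][X][X]}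
    (hG : IsGcd G (polyK x₁ x₂) (polyT x₁ x₂)) :
    ∃ z : RatFunc ℝ, z.num.natDegree ≤ 1 ∧ z.denom.natDegree ≤ 1 ∧ evalGraph r z G = 0 := by
  obtain ⟨hr, Q, hQ, b, hfb⟩ := hf
  rw [Matrix.mem_specialOrthogonalGroup_iff, Matrix.mem_orthogonalGroup_iff'] at hQ
  obtain ⟨hQ, hdet⟩ := hQ
  obtain ⟨σ, hσ⟩ := exists_algHom_of_aeval_eq_zero_iff hp₂ (aeval_similar_eq_zero_iff hfC hfb)
  have hsurj := surjective_of_similar hp₁ hr hQ hσ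
  have hD := ratDeriv_map_X_ne_zero hsurj
  have hσx : σ ∘ x₂ = x₁.similar r Q b := funext hσ
  have hκ : x₁.curvatureSq = RatFunc.C r ^ 2 * σ x₂.curvatureSq := by
    rw [← curvatureSq_comp x₂ hD, hσx, ← curvatureSq_similar x₁ hr hQ]
  have hτ : x₁.torsion = RatFunc.C r * σ x₂.torsion := by
    rw [← torsion_comp x₂ hD, hσx, ← torsion_similar x₁ hr hQ hdet]
  obtain ⟨μ₁, h₁⟩ := IsHelical.exists_curvatureSq_eq hh₁
  obtain ⟨μ₂, h₂⟩ := IsHelical.exists_curvatureSq_eq hh₂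
  have hμ : μ₁ ^ 2 = μ₂ ^ 2 := by
    have hC : ∀ c : ℝ, σ (RatFunc.C c) = RatFunc.C c := fun c => σ.commutes c
    have h := hκ
    rw [h₁, h₂, map_mul, map_pow σ, hC, mul_left_comm, ← mul_pow, ← hτ] at h
    exact RatFunc.C_injective
      (mul_right_cancel₀ (pow_ne_zero 2 (IsNonplanar.torsion_ne_zero hh₁.1)) h)
  -- T is a common divisor of K and T, so G inherits its zeros.
  have hTG : polyT x₁ x₂ ∣ G :=
    (hG _).2 ⟨polyT_dvd_polyK h₁ (by rw [h₂, hμ]), dvd_rfl⟩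
  obtain ⟨H, rfl⟩ := hTG
  refine ⟨σ RatFunc.X, (natDegree_map_X_le_one hsurj).1, (natDegree_map_X_le_one hsurj).2, ?_⟩
  rw [map_mul, evalGraph_polyT hτ, zero_mul]

/-! ### Polynomials vanishing along the graph of a Möbius map -/

theorem coeff_sum_monomial_derivative {R : Type*} [CommRing R] (F : R[X][X]) (i : ℕ) :
    (F.sum fun i c => Polynomial.monomial i (Polynomial.derivative c)).coeff i =
      Polynomial.derivative (F.coeff i) := by
  rw [Polynomial.sum_def, Polynomial.finsetSum_coeff]
  simp only [Polynomial.coeff_monomial]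
  rw [Finset.sum_ite_eq']
  split_ifs with h
  · rfl
  · rw [Polynomial.notMem_support_iff.1 h, Polynomial.derivative_zero]

/-- Differentiation of the coefficients of a bivariate polynomial. -/
def coeffDeriv (F : ℝ[X][X]) : ℝ[X][X] :=
  F.sum fun i c => Polynomial.monomial i (Polynomial.derivative c)

theorem coeff_coeffDeriv (F : ℝ[X][X]) (i : ℕ) :
    (coeffDeriv F).coeff i = Polynomial.derivative (F.coeff i) :=
  coeff_sum_monomial_derivative F i

theorem coeffDeriv_add (F H : ℝ[X][X]) : coeffDeriv (F + H) = coeffDeriv F + coeffDeriv H := by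
  ext1 i
  simp [coeff_coeffDeriv]

theorem coeffDeriv_sub (F H : ℝ[X][X]) : coeffDeriv (F - H) = coeffDeriv F - coeffDeriv H := by
  ext1 i
  simp [coeff_coeffDeriv]

theorem coeffDeriv_mul (F H : ℝ[X][X]) :
    coeffDeriv (F * H) = coeffDeriv F * H + F * coeffDeriv H := by
  ext1 i
  rw [coeff_coeffDeriv, Polynomial.coeff_add, Polynomial.coeff_mul, Polynomial.coeff_mul,
    Polynomial.coeff_mul, Polynomial.derivative_sum, ← Finset.sum_add_distrib]
  simp only [Polynomial.derivative_mul, coeff_coeffDeriv]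

theorem coeffDeriv_C (p : ℝ[X]) :
    coeffDeriv (Polynomial.C p) = Polynomial.C (Polynomial.derivative p) := by
  ext1 i
  rw [coeff_coeffDeriv, Polynomial.coeff_C, Polynomial.coeff_C]
  split_ifs <;> simp

theorem coeffDeriv_X : coeffDeriv Polynomial.X = 0 := by
  ext1 i
  rw [coeff_coeffDeriv, Polynomial.coeff_X]
  split_ifs <;> simp

/-- The specialization `l ↦ r`. -/
def specL (r : ℝ) : ℝ[X][X][X] →+* ℝ[X][X] :=
  Polynomial.mapRingHom (Polynomial.mapRingHom (Polynomial.evalRingHom r))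

theorem coeff_specL (r : ℝ) (H : ℝ[X][X][X]) (i : ℕ) :
    (specL r H).coeff i = (H.coeff i).map (Polynomial.evalRingHom r) := by
  simp [specL]

theorem specL_partialS (r : ℝ) (H : ℝ[X][X][X]) :
    specL r (partialS H) = Polynomial.derivative (specL r H) := by
  simp [specL, partialS, Polynomial.derivative_map]

theorem specL_partialT (r : ℝ) (H : ℝ[X][X][X]) :
    specL r (partialT H) = coeffDeriv (specL r H) := by
  ext1 i
  rw [coeff_coeffDeriv, coeff_specL, coeff_specL, partialT, coeff_sum_monomial_derivative,
    Polynomial.derivative_map]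

/-- Evaluation of a bivariate polynomial at `(t₀, s₀)`. -/
def evalTS (t₀ s₀ : ℝ) : ℝ[X][X] →+* ℝ :=
  (Polynomial.evalRingHom s₀).comp (Polynomial.mapRingHom (Polynomial.evalRingHom t₀))

theorem evalTS_C (t₀ s₀ : ℝ) (p : ℝ[X]) : evalTS t₀ s₀ (Polynomial.C p) = p.eval t₀ := by
  simp [evalTS]

theorem evalTS_X (t₀ s₀ : ℝ) : evalTS t₀ s₀ Polynomial.X = s₀ := by
  simp [evalTS]

theorem eval_eval_C (c : ℝ[X][X]) (r t₀ : ℝ) :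
    (c.eval (Polynomial.C t₀)).eval r = (c.map (Polynomial.evalRingHom r)).eval t₀ := by
  have h : (Polynomial.evalRingHom r).comp (Polynomial.evalRingHom (Polynomial.C t₀)) =
      (Polynomial.evalRingHom t₀).comp (Polynomial.mapRingHom (Polynomial.evalRingHom r)) := by
    ext <;> simp
  exact RingHom.congr_fun h c

/-- The two orders of specialization agree. The inner variable filled by `evalTS` is l on the left
and t on the right. -/
theorem evalTS_atT (H : ℝ[X][X][X]) (r t₀ s₀ : ℝ) :
    evalTS r s₀ (atT H t₀) = evalTS t₀ s₀ (specL r H) := by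
  rw [evalTS, evalTS, RingHom.comp_apply, RingHom.comp_apply]
  refine congrArg _ ?_
  ext1 i
  simp [atT, coeff_specL, eval_eval_C]

theorem evalGraph_eq_eval₂ (r : ℝ) (z : RatFunc ℝ) (G : ℝ[X][X][X]) :
    evalGraph r z G = (specL r G).eval₂ (algebraMap ℝ[X] (RatFunc ℝ)) z := by
  rw [evalGraph, specL, Polynomial.coe_eval₂RingHom, Polynomial.coe_mapRingHom,
    Polynomial.eval₂_map]

/-- Gauss's lemma: the linear factor is primitive by coprimality, and over ℝ(t) it is a unit times
`X - C z`. -/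
theorem dvd_of_eval₂_eq_zero {F : ℝ[X][X]} {z : RatFunc ℝ}
    (h : F.eval₂ (algebraMap ℝ[X] (RatFunc ℝ)) z = 0) :
    Polynomial.C z.denom * Polynomial.X - Polynomial.C z.num ∣ F := by
  have hd := RatFunc.algebraMap_ne_zero z.denom_ne_zero
  have hprim : (Polynomial.C z.denom * Polynomial.X - Polynomial.C z.num).IsPrimitive := by
    intro c hc
    rw [Polynomial.C_dvd_iff_dvd_coeff] at hc
    have h0 := hc 0
    have h1 := hc 1
    simp only [Polynomial.coeff_sub, Polynomial.coeff_C_mul, Polynomial.coeff_X_zero, mul_zero,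
      Polynomial.coeff_C_zero, zero_sub, dvd_neg, Polynomial.coeff_X_one, mul_one,
      Polynomial.coeff_C_succ, sub_zero] at h0 h1
    exact (RatFunc.isCoprime_num_denom z).isUnit_of_dvd' h0 h1
  refine hprim.dvd_of_fraction_map_dvd_fraction_map (K := RatFunc ℝ) ?_
  have hmap : (Polynomial.C z.denom * Polynomial.X - Polynomial.C z.num).map
      (algebraMap ℝ[X] (RatFunc ℝ)) =
      Polynomial.C (algebraMap ℝ[X] (RatFunc ℝ) z.denom) * (Polynomial.X - Polynomial.C z) := by
    have e := (eq_div_iff hd).1 (RatFunc.num_div_denom z).symm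
    rw [mul_sub, ← Polynomial.C_mul, mul_comm _ z, e]
    simp
  rw [hmap]
  refine (Polynomial.isUnit_C.2 hd.isUnit).mul_left_dvd.2 ?_
  rw [Polynomial.dvd_iff_isRoot, Polynomial.IsRoot, Polynomial.eval_map, h]

theorem sum_homogenized_eq_zero {F : ℝ[X][X]} {z : RatFunc ℝ} {n : ℕ} (hn : F.natDegree ≤ n)
    (h : F.eval₂ (algebraMap ℝ[X] (RatFunc ℝ)) z = 0) :
    ∑ i ∈ Finset.range (n + 1), F.coeff i * z.num ^ i * z.denom ^ (n - i) = 0 := by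
  have hd := RatFunc.algebraMap_ne_zero z.denom_ne_zero
  refine RatFunc.algebraMap_injective ℝ ?_
  rw [map_zero, map_sum]
  rw [Polynomial.eval₂_eq_sum_range' _ (Nat.lt_succ_of_le hn)] at h
  rw [← mul_zero (algebraMap ℝ[X] (RatFunc ℝ) z.denom ^ n), ← h, Finset.mul_sum]
  refine Finset.sum_congr rfl fun i hi => ?_
  have hi' : i ≤ n := Nat.lt_succ_iff.1 (Finset.mem_range.1 hi)
  have e := (eq_div_iff hd).1 (RatFunc.num_div_denom z).symm
  obtain ⟨k, rfl⟩ := Nat.exists_eq_add_of_le hi'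
  rw [map_mul, map_mul, map_pow, map_pow, ← e, Nat.add_sub_cancel_left]
  ring

theorem natDegree_specL_le (r : ℝ) (G : ℝ[X][X][X]) : (specL r G).natDegree ≤ G.natDegree :=
  Polynomial.natDegree_map_le

theorem leadCoeffAt_eval (r t₀ : ℝ) (G : ℝ[X][X][X]) :
    (leadCoeffAt G t₀).eval r = ((specL r G).coeff G.natDegree).eval t₀ := by
  rw [leadCoeffAt, eval_eval_C, coeff_specL, Polynomial.leadingCoeff]

theorem leadCoeffAt_eval_eq_zero {r t₀ : ℝ} {G : ℝ[X][X][X]} {z : RatFunc ℝ}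
    (h : evalGraph r z G = 0) (hz : z.denom.eval t₀ = 0) : (leadCoeffAt G t₀).eval r = 0 := by
  rw [evalGraph_eq_eval₂] at h
  have hsum := congrArg (Polynomial.eval t₀)
    -- At a pole every term except the top one contains a power of the vanishing denominator.
    (sum_homogenized_eq_zero (natDegree_specL_le r G) h)
  have hnum : z.num.eval t₀ ≠ 0 := by
    intro h0
    obtain ⟨a, b, hab⟩ := RatFunc.isCoprime_num_denom z
    have := congrArg (Polynomial.eval t₀) hab
    simp [h0, hz] at this
  rw [Finset.sum_range_succ, Polynomial.eval_add, Polynomial.eval_finsetSum,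
    Finset.sum_eq_zero, zero_add, Nat.sub_self, pow_zero, mul_one, Polynomial.eval_mul,
    Polynomial.eval_pow, Polynomial.eval_zero] at hsum
  · rw [leadCoeffAt_eval]
    exact (mul_eq_zero.1 hsum).resolve_right (pow_ne_zero _ hnum)
  · intro i hi
    rw [Polynomial.eval_mul, Polynomial.eval_pow, hz,
      zero_pow (Nat.sub_ne_zero_of_lt (Finset.mem_range.1 hi)), mul_zero]

/-- The coefficients `a, b, c, d` recover the Möbius map, up to a common factor. -/
theorem exists_eval_coeffs_eq {r t₀ : ℝ} {G : ℝ[X][X][X]} {z : RatFunc ℝ}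
    (hnum : z.num.natDegree ≤ 1) (hdenom : z.denom.natDegree ≤ 1) (h : evalGraph r z G = 0)
    {s₀ : ℝ} (hs : z.denom.eval t₀ * s₀ = z.num.eval t₀) :
    ∃ k : ℝ, evalTS r s₀ (coeffA G t₀) = k * z.num.coeff 1 ∧
      evalTS r s₀ (coeffB G t₀) = k * z.num.coeff 0 ∧
      evalTS r s₀ (coeffC G t₀) = k * z.denom.coeff 1 ∧
      evalTS r s₀ (coeffD G t₀) = k * z.denom.coeff 0 := by
  rw [evalGraph_eq_eval₂] at h
  obtain ⟨E, hE⟩ := dvd_of_eval₂_eq_zero h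
  have hn := Polynomial.eq_X_add_C_of_natDegree_le_one hnum
  have hd := Polynomial.eq_X_add_C_of_natDegree_le_one hdenom
  generalize z.num.coeff 1 = α at *
  generalize z.num.coeff 0 = β at *
  generalize z.denom.coeff 1 = γ at *
  generalize z.denom.coeff 0 = δ at *
  have hdn : Polynomial.derivative z.num = Polynomial.C α := by rw [hn]; simp
  have hdd : Polynomial.derivative z.denom = Polynomial.C γ := by rw [hd]; simp
  have hen : z.num.eval t₀ = α * t₀ + β := by rw [hn]; simp
  have hed : z.denom.eval t₀ = γ * t₀ + δ := by rw [hd]; simp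
  rw [hen, hed] at hs
  obtain ⟨W, hW⟩ : ∃ W, W = Polynomial.C z.denom * Polynomial.X - Polynomial.C z.num := ⟨_, rfl⟩
  obtain ⟨V, hV⟩ : ∃ V : ℝ[X][X], V = Polynomial.C (Polynomial.C γ) * Polynomial.X -
    Polynomial.C (Polynomial.C α) := ⟨_, rfl⟩
  have hWs : Polynomial.derivative W = Polynomial.C z.denom := by rw [hW]; simp
  have hWt : coeffDeriv W = V := by
    rw [hW, hV, coeffDeriv_sub, coeffDeriv_mul, coeffDeriv_C, coeffDeriv_C, coeffDeriv_X, hdn,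
      hdd, mul_zero, add_zero]
  have hVs : Polynomial.derivative V = Polynomial.C (Polynomial.C γ) := by rw [hV]; simp
  have hVt : coeffDeriv V = 0 := by
    rw [hV, coeffDeriv_sub, coeffDeriv_mul, coeffDeriv_C, coeffDeriv_C, coeffDeriv_X]
    simp
  -- The point lies on the graph, so in G = W E each term where W stays undifferentiated drops out.
  have eW : evalTS t₀ s₀ W = 0 := by
    rw [hW, map_sub, map_mul, evalTS_C, evalTS_C, evalTS_X, hen, hed, hs, sub_self]
  have eV : evalTS t₀ s₀ V = γ * s₀ - α := by
    rw [hV, map_sub, map_mul, evalTS_C, evalTS_C, evalTS_X, Polynomial.eval_C, Polynomial.eval_C]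
  rw [← hW] at hE
  have hGs : evalTS r s₀ (atT (partialS G) t₀) = (γ * t₀ + δ) * evalTS t₀ s₀ E := by
    rw [evalTS_atT, specL_partialS, hE]
    simp only [Polynomial.derivative_mul, hWs, map_add, map_mul, evalTS_C, eW, hed]
    ring
  have hGt : evalTS r s₀ (atT (partialT G) t₀) = (γ * s₀ - α) * evalTS t₀ s₀ E := by
    rw [evalTS_atT, specL_partialT, hE]
    simp only [coeffDeriv_mul, hWt, map_add, map_mul, eW, eV]
    ring
  have hGss : evalTS r s₀ (atT (partialS (partialS G)) t₀) =
      2 * (γ * t₀ + δ) * evalTS t₀ s₀ (Polynomial.derivative E) := by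
    rw [evalTS_atT, specL_partialS, specL_partialS, hE]
    simp only [Polynomial.derivative_mul, Polynomial.derivative_C, hWs,
      map_add, map_mul, map_zero, evalTS_C, eW, hed]
    ring
  have hGts : evalTS r s₀ (atT (partialS (partialT G)) t₀) =
      γ * evalTS t₀ s₀ E + (γ * t₀ + δ) * evalTS t₀ s₀ (coeffDeriv E) +
        (γ * s₀ - α) * evalTS t₀ s₀ (Polynomial.derivative E) := by
    rw [evalTS_atT, specL_partialS, specL_partialT, hE]
    simp only [coeffDeriv_mul, Polynomial.derivative_mul, hWs, hWt, hVs,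
      map_add, map_mul, evalTS_C, Polynomial.eval_C, eW, eV, hed]
    ring
  have hGtt : evalTS r s₀ (atT (partialT (partialT G)) t₀) =
      2 * (γ * s₀ - α) * evalTS t₀ s₀ (coeffDeriv E) := by
    rw [evalTS_atT, specL_partialT, specL_partialT, hE]
    simp only [coeffDeriv_mul, coeffDeriv_add, hWt, hVt, map_add, map_mul, map_zero, eW, eV]
    ring
  -- The first derivatives of the cofactor E cancel in M, leaving only E³.
  have hM : evalTS r s₀ (coeffM G t₀) =
      -2 * (γ * s₀ - α) * (γ * t₀ + δ) * γ * evalTS t₀ s₀ E ^ 3 := by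
    have hexp : coeffM G t₀ =
        atT (partialS G) t₀ ^ 2 * atT (partialT (partialT G)) t₀
          - 2 * atT (partialT G) t₀ * atT (partialS G) t₀ * atT (partialS (partialT G)) t₀
          + atT (partialT G) t₀ ^ 2 * atT (partialS (partialS G)) t₀ := by
      simp [coeffM, atT, Polynomial.map_pow]
    rw [hexp]
    simp only [map_add, map_sub, map_mul, map_pow, map_ofNat, hGs, hGt, hGss, hGts, hGtt]
    ring
  -- The factor is read off from c = −M. It may be zero; only the formula for b uses that s₀ is the
  -- value of the map.
  refine ⟨2 * (γ * s₀ - α) * (γ * t₀ + δ) * evalTS t₀ s₀ E ^ 3, ?_, ?_, ?_, ?_⟩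
  · simp only [coeffA, map_sub, map_neg, map_mul, map_pow, map_ofNat, evalTS_X, hGs, hGt, hM]
    ring
  · simp only [coeffB, constT, map_add, map_mul, map_pow, map_ofNat, evalTS_X, evalTS_C,
      Polynomial.eval_C, hGs, hGt, hM]
    linear_combination (2 * (γ * s₀ - α) * (γ * t₀ + δ) * evalTS t₀ s₀ E ^ 3) * hs
  · simp only [coeffC, map_neg, hM]
    ring
  · simp only [coeffD, constT, map_add, map_mul, map_pow, map_ofNat, evalTS_C,
      Polynomial.eval_C, hGs, hGt, hM]
    ring

theorem map_polyP_eq_zero {r t₀ : ℝ} {G : ℝ[X][X][X]} {z : RatFunc ℝ}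
    (hnum : z.num.natDegree ≤ 1) (hdenom : z.denom.natDegree ≤ 1) (h : evalGraph r z G = 0)
    {s₀ : ℝ} (hs : z.denom.eval t₀ * s₀ = z.num.eval t₀) :
    (polyP G t₀).map (evalTS r s₀) = 0 := by
  obtain ⟨k, hA, hB, hC, hD⟩ := exists_eval_coeffs_eq hnum hdenom h hs
  rw [evalGraph_eq_eval₂] at h
  have hsum := sum_homogenized_eq_zero (natDegree_specL_le r G) h
  have hn := Polynomial.eq_X_add_C_of_natDegree_le_one hnum
  have hd := Polynomial.eq_X_add_C_of_natDegree_le_one hdenom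
  have hcoeff : ∀ i, ((G.coeff i).map Polynomial.C).map (evalTS r s₀) = (specL r G).coeff i := by
    intro i
    rw [Polynomial.map_map, coeff_specL]
    congr 1
    ext c <;> simp [evalTS]
  rw [polyP, Polynomial.map_sum, ← mul_zero (Polynomial.C k ^ G.natDegree), ← hsum,
    Finset.mul_sum]
  refine Finset.sum_congr rfl fun i hi => ?_
  obtain ⟨m, hm⟩ := Nat.exists_eq_add_of_le (Nat.lt_succ_iff.1 (Finset.mem_range.1 hi))
  rw [Polynomial.map_mul, Polynomial.map_mul, hcoeff, Polynomial.map_pow, Polynomial.map_pow,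
    Polynomial.map_add, Polynomial.map_add, Polynomial.map_mul, Polynomial.map_mul,
    Polynomial.map_X, Polynomial.map_C, Polynomial.map_C, Polynomial.map_C, Polynomial.map_C,
    hA, hB, hC, hD, hm, Nat.add_sub_cancel_left]
  have hn' : Polynomial.C (k * z.num.coeff 1) * Polynomial.X + Polynomial.C (k * z.num.coeff 0) =
      Polynomial.C k * z.num := by
    conv_rhs => rw [hn]
    simp only [Polynomial.C_mul]
    ring
  have hd' : Polynomial.C (k * z.denom.coeff 1) * Polynomial.X +
      Polynomial.C (k * z.denom.coeff 0) = Polynomial.C k * z.denom := by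
    conv_rhs => rw [hd]
    simp only [Polynomial.C_mul]
    ring
  rw [hn', hd']
  ring

theorem polyLambda_eval_eq_zero {r t₀ s₀ : ℝ} {G : ℝ[X][X][X]}
    (h : (polyP G t₀).map (evalTS r s₀) = 0) : (polyLambda G t₀).eval r = 0 := by
  have hmem : Polynomial.C (polyLambda G t₀) ∈ idealP G t₀ :=
    Submodule.IsPrincipal.generator_mem (elimIdeal G t₀)
  -- All generators vanish at (s₀, r), and Λ, a member of the ideal free of s₀, takes there the
  -- value Λ(r).
  have hle : idealP G t₀ ≤ RingHom.ker (evalTS r s₀) := by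
    refine Ideal.span_le.2 (Set.range_subset_iff.2 fun i => ?_)
    have := congrArg (fun q => Polynomial.coeff q i) h
    simpa using this
  have := RingHom.mem_ker.1 (hle hmem)
  rwa [evalTS_C] at this

end SimilarCurves

end

theorem mainTheorem5 (x₁ x₂ : SimilarCurves.Param)
    (hp₁ : x₁.IsProper) (hp₂ : x₂.IsProper)
    (hh₁ : x₁.IsHelical) (hh₂ : x₂.IsHelical)
    (f : (Fin 3 → ℝ) → (Fin 3 → ℝ)) (r : ℝ)
    (hf : SimilarCurves.IsSimilarity f r)
    (hfC : f '' x₁.curve = x₂.curve)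
    (G : Polynomial (Polynomial (Polynomial ℝ)))
    (hG : SimilarCurves.IsGcd G (SimilarCurves.polyK x₁ x₂) (SimilarCurves.polyT x₁ x₂))
    (t₀ : ℝ) (ht₀ : SimilarCurves.leadCoeffAt G t₀ ≠ 0) :
    r ∈ SimilarCurves.setS0 G t₀ ∪ SimilarCurves.setS1 G t₀ ∪ SimilarCurves.setS2 G t₀ := by
  obtain ⟨z, hnum, hdenom, hz⟩ := SimilarCurves.exists_mobius hp₁ hp₂ hh₁ hh₂ hf hfC hG
  left
  -- A pole at t₀ leads to S₁; a finite value s₀ = z(t₀) leads to S₀.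
  by_cases hq : z.denom.eval t₀ = 0
  · exact Or.inr ⟨hf.1, SimilarCurves.leadCoeffAt_eval_eq_zero hz hq⟩
  · exact Or.inl ⟨hf.1, SimilarCurves.polyLambda_eval_eq_zero
      (SimilarCurves.map_polyP_eq_zero hnum hdenom hz (mul_div_cancel₀ _ hq))⟩
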